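/- For $\theta,\sigma>0$ and $\mu,x_0\in\mathbb R$, the Ornstein--Uhlenbeck (OU) process with parameters $(\theta,\mu,\sigma)$ and deterministic initial value $x_0$, driven by a standard real Wiener process $W$, is the continuous solution of $$dX_t=\theta(\mu-X_t)\,dt+\sigma\,dW_t,\qquad X_0=x_0,\quad t\ge 0 .$$ (a) Let $X^1,X^2$ be OU processes with parameters $(\theta_i,\mu_i,\sigma_i)$, $\theta_i,\sigma_i>0$, and deterministic initial values $x_0^i$, driven by the same Wiener process. Then for every $0\le T<\infty$ the variables $X^1_T,X^2_T$ are square integrable and $$\mathrm{Cov}[X^1_T,X^2_T]=\frac{\sigma_1\sigma_2\,\bigl(1-e^{-(\theta_1+\theta_2)T}\bigr)}{\theta_1+\theta_2}.$$ Moreover $$\lim_{T\to\infty}\mathrm{Var}[X^1_T-X^2_T]=\frac{\sigma_1^2}{2\theta_1}+\frac{\sigma_2^2}{2\theta_2}-\frac{2\sigma_1\sigma_2}{\theta_1+\theta_2},$$ and this constant is strictly positive if $(\theta_1,\sigma_1)\ne(\theta_2,\sigma_2)$. Now fix $\theta,\sigma>0$ and $0<T<\infty$. Let $(a_1(\varepsilon),a_2(\varepsilon))$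 be $(\varepsilon,-\varepsilon)$, $(\varepsilon,0)$ or $(0,-\varepsilon)$ (central, forward or backward difference). Let $X^1,X^2$ be OU processes with the same $\mu\in\mathbb R$ and the same deterministic initial value $x_0$, and with either $\theta_i=\theta+a_i(\varepsilon)$, $\sigma_i=\sigma$ (sensitivity with respect to $\theta$), or $\theta_i=\theta$, $\sigma_i=\sigma+a_i(\varepsilon)$ (sensitivity with respect to $\sigma$). Then, as $\varepsilon\to0$, with constants in the $O$- and $\Theta$-terms and a range of $\varepsilon$ that depend only on $\theta$, $\sigma$, $T$ and the difference scheme: (b) (common random paths) if $X^1$ and $X^2$ are driven by the same Wiener process, then $X^1_T-X^2_T$ is square integrable and $\mathrm{Var}[X^1_T-X^2_T]=O(\varepsilon^2)$; (c) (independent paths) if $X^1$ and $X^2$ are driven by two independent Wiener processes, then $X^1_T-X^2_T$ is square integrable and $$\mathrm{Var}[X^1_T-X^2_T]=\mathrm{Var}[X^1_T]+\mathrm{Var}[X^2_T]=\sigma^2\theta^{-1}-\sigma^2\theta^{-1}e^{-2T\theta}+O(\varepsilon);$$ in particular it is $O(1)$, and in fact $\Theta(1)$: it is bounded above and bounded away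 from zero for all small $\varepsilon$. -/

import Mathlib

open MeasureTheory ProbabilityTheory Filter Topology
open scoped NNReal

universe u

/-- `X` is the Ornstein-Uhlenbeck process with parameters `θ`, `μ`, `σ` and deterministic initial
value `x₀`, driven by the Wiener process `W`: a process with almost surely continuous paths which
solves `dX_t = θ (μ - X_t) dt + σ dW_t`, `X_0 = x₀`. As the noise is additive, the equation is
the pathwise integral equation `X_t = x₀ + ∫_0^t θ (μ - X_s) ds + σ W_t` for all `t ≥ 0`.
(Its solution is automatically adapted to the completed filtration of `W`.) -/
structure IsOUProcess {Ω : Type*} [MeasurableSpace Ω] (θ μ σ x₀ : ℝ)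
    (W X : ℝ≥0 → Ω → ℝ) (P : Measure Ω) : Prop where
  wiener : IsBrownianReal W P
  cont : ∀ᵐ ω ∂P, Continuous fun t : ℝ≥0 => X t ω
  init : ∀ᵐ ω ∂P, X 0 ω = x₀
  sde : ∀ᵐ ω ∂P, ∀ t : ℝ≥0,
    X t ω = x₀ + (∫ s in (0 : ℝ)..(t : ℝ), θ * (μ - X s.toNNReal ω)) + σ * W t ω

/-- Common random path coupling: OU processes with parameters `(θ₁, σ₁)` and `(θ₂, σ₂)`, and the
same `μ` and deterministic initial value `x₀`, driven by one Wiener process. -/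
def IsCommonPathPair {Ω : Type*} [MeasurableSpace Ω] (θ₁ σ₁ θ₂ σ₂ μ x₀ : ℝ)
    (X₁ X₂ : ℝ≥0 → Ω → ℝ) (P : Measure Ω) : Prop :=
  ∃ W : ℝ≥0 → Ω → ℝ, IsOUProcess θ₁ μ σ₁ x₀ W X₁ P ∧ IsOUProcess θ₂ μ σ₂ x₀ W X₂ P

/-- Independent sampling: OU processes with parameters `(θ₁, σ₁)` and `(θ₂, σ₂)`, and the
same `μ` and deterministic initial value `x₀`, driven by two independent Wiener processes. -/
def IsIndependentPathPair {Ω : Type*} [MeasurableSpace Ω] (θ₁ σ₁ θ₂ σ₂ μ x₀ : ℝ)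
    (X₁ X₂ : ℝ≥0 → Ω → ℝ) (P : Measure Ω) : Prop :=
  ∃ W₁ W₂ : ℝ≥0 → Ω → ℝ,
    IndepFun (fun ω (t : ℝ≥0) => W₁ t ω) (fun ω (t : ℝ≥0) => W₂ t ω) P ∧
    IsOUProcess θ₁ μ σ₁ x₀ W₁ X₁ P ∧ IsOUProcess θ₂ μ σ₂ x₀ W₂ X₂ P

/-- The standard first order finite differences. -/
inductive FirstOrderDifference : Type
  | central
  | forward
  | backward

/-- The perturbation of the parameter in the first evaluation point, as a function of the
step `ε`: `ε`, `ε`, `0` for the central, forward and backward difference. -/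
def FirstOrderDifference.shift₁ : FirstOrderDifference → ℝ → ℝ
  | central, ε => ε
  | forward, ε => ε
  | backward, _ => 0

/-- The perturbation of the parameter in the second evaluation point, as a function of the
step `ε`: `-ε`, `0`, `-ε` for the central, forward and backward difference. -/
def FirstOrderDifference.shift₂ : FirstOrderDifference → ℝ → ℝ
  | central, ε => -ε
  | forward, _ => 0
  | backward, ε => -ε

/-! Since the noise is additive, the equation can be solved path by path: `X_T` minus its mean is
the almost sure limit of Riemann-Stieltjes sums of `σ e^{-θ(T-s)}` against `W`
(`tendsto_stieltjesSum_of_linear_equation`). No stochastic integral is needed. Each such sum is a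
centred Gaussian whose variance is a left Riemann sum of the squared kernel, so the limit is
Gaussian with variance the integral of that square (`hasLaw_of_tendsto_stieltjesSum`).

Processes with a common driver combine linearly into one such limit with the combined kernel, which
gives all variances, and the covariance by polarisation. For common paths the two kernels differ by
`O(ε)` uniformly on `[0, T]`, hence the variance is `O(ε²)`. For independent paths each `X_T` is
almost surely a measurable function of its own driver, so the variances add; each is Lipschitz in
the parameters and tends to a positive value. -/

/-! ### Equidistant partitions and Riemann sums -/

/-- The `k`-th point of the partition of `[0, T]` into `n + 1` intervals of equal length. -/
noncomputable def partitionPoint (T : ℝ≥0) (n k : ℕ) : ℝ≥0 := T * k / (n + 1)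

lemma coe_partitionPoint (T : ℝ≥0) (n k : ℕ) :
    (partitionPoint T n k : ℝ) = T * k / (n + 1) := by
  simp [partitionPoint]

@[simp]
lemma partitionPoint_zero (T : ℝ≥0) (n : ℕ) : partitionPoint T n 0 = 0 := by
  simp [partitionPoint]

@[simp]
lemma partitionPoint_last (T : ℝ≥0) (n : ℕ) : partitionPoint T n (n + 1) = T := by
  simp only [partitionPoint]
  push_cast
  field_simp

lemma partitionPoint_mono (T : ℝ≥0) (n : ℕ) : Monotone (partitionPoint T n) := by
  intro k l hkl
  simp only [partitionPoint]
  gcongr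

lemma partitionPoint_succ_sub (T : ℝ≥0) (n k : ℕ) :
    (partitionPoint T n (k + 1) : ℝ) - partitionPoint T n k = T / (n + 1) := by
  simp only [coe_partitionPoint]
  push_cast
  ring

/-- Local errors which vanish on the diagonal are negligible on fine partitions. -/
lemma tendsto_sum_integral_of_vanish_diagonal {G : ℝ × ℝ × ℝ → ℝ} (hG : Continuous G)
    (hdiag : ∀ a, G (a, a, a) = 0) (T : ℝ≥0) :
    Tendsto (fun n : ℕ => ∑ k ∈ Finset.range (n + 1),
      ∫ s in (partitionPoint T n k : ℝ)..(partitionPoint T n (k + 1) : ℝ),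
        G (partitionPoint T n k, s, partitionPoint T n (k + 1))) atTop (𝓝 0) := by
  set K : Set ℝ := Set.Icc 0 (T : ℝ) with hK
  have huc : UniformContinuousOn G (K ×ˢ K ×ˢ K) :=
    (isCompact_Icc.prod (isCompact_Icc.prod isCompact_Icc)).uniformContinuousOn_of_continuous
      hG.continuousOn
  rw [Metric.uniformContinuousOn_iff] at huc
  rw [Metric.tendsto_atTop]
  intro η hη
  -- The cells have total length `T`, so the errors sum to at most `η T / (T + 1) < η`; the `+ 1`
  -- also covers `T = 0`.
  obtain ⟨δ, hδ, h⟩ := huc (η / (T + 1)) (by positivity)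
  have hlim : Tendsto (fun n : ℕ => (T : ℝ) / ((n : ℝ) + 1)) atTop (𝓝 0) :=
    tendsto_const_nhds.div_atTop (tendsto_natCast_atTop_atTop.atTop_add tendsto_const_nhds)
  obtain ⟨N, hN⟩ := eventually_atTop.1 (hlim.eventually (gt_mem_nhds hδ))
  refine ⟨N, fun n hn => ?_⟩
  have hmesh := hN n hn
  rw [dist_zero_right]
  have hterm : ∀ k ∈ Finset.range (n + 1),
      ‖∫ s in (partitionPoint T n k : ℝ)..(partitionPoint T n (k + 1) : ℝ),
        G (partitionPoint T n k, s, partitionPoint T n (k + 1))‖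
          ≤ η / (T + 1) * (T / (n + 1)) := by
    intro k hk
    have hk' : k + 1 ≤ n + 1 := by simpa [Nat.lt_succ_iff] using hk
    have hsub := partitionPoint_succ_sub T n k
    have hle : (partitionPoint T n k : ℝ) ≤ partitionPoint T n (k + 1) :=
      NNReal.coe_le_coe.2 (partitionPoint_mono T n k.le_succ)
    have hleT : (partitionPoint T n (k + 1) : ℝ) ≤ T := by
      have := partitionPoint_mono T n hk'
      rw [partitionPoint_last] at this
      exact NNReal.coe_le_coe.2 this
    have hnn : (0 : ℝ) ≤ partitionPoint T n k := NNReal.coe_nonneg _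
    rw [← hsub]
    refine (intervalIntegral.norm_integral_le_of_norm_le_const (C := η / (T + 1))
      fun s hs => ?_).trans_eq (by rw [abs_of_nonneg (sub_nonneg.2 hle)])
    rw [Set.uIoc_of_le hle] at hs
    have := h (partitionPoint T n k, s, partitionPoint T n (k + 1))
      ⟨⟨hnn, by linarith⟩, ⟨by linarith [hs.1], by linarith [hs.2]⟩, ⟨by linarith, hleT⟩⟩
      (partitionPoint T n k, partitionPoint T n k, partitionPoint T n k)
      ⟨⟨hnn, by linarith⟩, ⟨hnn, by linarith⟩, ⟨hnn, by linarith⟩⟩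
      (by
        simp only [Prod.dist_eq, dist_self, Real.dist_eq]
        refine max_lt hδ (max_lt ?_ ?_)
        · rw [abs_of_nonneg (by linarith [hs.1])]; linarith [hs.2]
        · rw [abs_of_nonneg (by linarith)]; linarith)
    rw [hdiag, dist_zero_right] at this
    exact this.le
  calc _ ≤ ∑ k ∈ Finset.range (n + 1), η / (T + 1) * ((T : ℝ) / (n + 1)) :=
        norm_sum_le_of_le _ hterm
    _ = η * (T / (T + 1)) := by
        rw [Finset.sum_const, Finset.card_range, nsmul_eq_mul]
        push_cast
        have : (0 : ℝ) < T + 1 := by positivity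
        field_simp
    _ < η * 1 := by
        have : (0 : ℝ) < T + 1 := by positivity
        gcongr
        rw [div_lt_one this]
        linarith
    _ = η := mul_one η

lemma sum_integral_partition {f : ℝ → ℝ} (hf : Continuous f) (T : ℝ≥0) (n : ℕ) :
    ∑ k ∈ Finset.range (n + 1),
      ∫ s in (partitionPoint T n k : ℝ)..(partitionPoint T n (k + 1) : ℝ), f s =
        ∫ s in (0 : ℝ)..T, f s := by
  have := intervalIntegral.sum_integral_adjacent_intervals (μ := volume) (f := f)
    (a := fun k => (partitionPoint T n k : ℝ)) (n := n + 1)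
    (fun k _ => hf.intervalIntegrable _ _)
  simpa using this

/-- The error on a cell is the integral of `f a - f s`, with `a` the left endpoint, and this
vanishes on the diagonal. -/
lemma tendsto_leftRiemannSum {f : ℝ → ℝ} (hf : Continuous f) (T : ℝ≥0) :
    Tendsto (fun n : ℕ => ∑ k ∈ Finset.range (n + 1),
      f (partitionPoint T n k) * ((partitionPoint T n (k + 1) : ℝ) - partitionPoint T n k))
      atTop (𝓝 (∫ s in (0 : ℝ)..T, f s)) := by
  have h := tendsto_sum_integral_of_vanish_diagonal
    (G := fun p => f p.1 - f p.2.1) (by fun_prop) (by simp) T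
  have h' := h.add_const (∫ s in (0 : ℝ)..T, f s)
  rw [zero_add] at h'
  refine h'.congr fun n => ?_
  rw [← sum_integral_partition hf T n, ← Finset.sum_add_distrib]
  refine Finset.sum_congr rfl fun k _ => ?_
  dsimp only
  rw [intervalIntegral.integral_sub intervalIntegrable_const (hf.intervalIntegrable _ _)]
  simp [mul_comm]

/-! ### Pathwise solution by Stieltjes sums -/

/-- The Riemann-Stieltjes sum of `c` against the path `w` over the equidistant partition. -/
noncomputable def stieltjesSum (c : ℝ → ℝ) (T : ℝ≥0) (n : ℕ) (w : ℝ≥0 → ℝ) : ℝ :=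
  ∑ k ∈ Finset.range (n + 1),
    c (partitionPoint T n k) * (w (partitionPoint T n (k + 1)) - w (partitionPoint T n k))

lemma measurable_stieltjesSum (c : ℝ → ℝ) (T : ℝ≥0) (n : ℕ) :
    Measurable (stieltjesSum c T n) := by
  unfold stieltjesSum
  fun_prop

/-- The Stieltjes sums of the exponential kernel against the noise converge to the centred
solution of the linear equation, for each continuous path. -/
lemma tendsto_stieltjesSum_of_linear_equation {θ μ σ x₀ : ℝ} {w x : ℝ≥0 → ℝ}
    (hx : Continuous x) (h0 : x 0 = x₀)
    (hsde : ∀ t : ℝ≥0,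
      x t = x₀ + (∫ s in (0 : ℝ)..(t : ℝ), θ * (μ - x s.toNNReal)) + σ * w t)
    (T : ℝ≥0) :
    Tendsto (fun n => stieltjesSum (fun s => σ * Real.exp (-θ * (T - s))) T n w) atTop
      (𝓝 (x T - (μ + (x₀ - μ) * Real.exp (-θ * T)))) := by
  set V : ℝ → ℝ := fun s => x s.toNNReal - μ with hV
  have hVc : Continuous V := by fun_prop
  have hVcoe : ∀ t : ℝ≥0, V t = x t - μ := fun t => by simp [hV]
  -- The equation turns noise increments into increments of `V` plus a drift integral, so no
  -- regularity of `w` is needed.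
  have hinc : ∀ a b : ℝ≥0, σ * (w b - w a) = V b - V a + θ * ∫ s in (a : ℝ)..b, V s := by
    intro a b
    have hI : ∀ t : ℝ≥0, (∫ s in (0 : ℝ)..(t : ℝ), θ * (μ - x s.toNNReal)) =
        -θ * ∫ s in (0 : ℝ)..t, V s := by
      intro t
      rw [← intervalIntegral.integral_const_mul]
      congr 1
      ext s
      simp only [hV]
      ring
    have ha := hsde a
    have hb := hsde b
    rw [hI] at ha hb
    have := intervalIntegral.integral_interval_sub_left
      (hVc.intervalIntegrable (μ := volume) 0 b) (hVc.intervalIntegrable 0 a)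
    rw [← this, hVcoe, hVcoe]
    linarith
  -- This is the discrete integration-by-parts error: on a cell `[a, b]`, the increment of
  -- `e^{-θ(T-s)} V s` minus the Stieltjes term is the integral of this function at `(a, s, b)`. The
  -- increments telescope to the limit.
  have hlim := tendsto_sum_integral_of_vanish_diagonal
    (G := fun p => Real.exp (-θ * T) * θ *
      (Real.exp (θ * p.2.1) * V p.2.2 - Real.exp (θ * p.1) * V p.2.1))
    (by fun_prop) (by simp) T
  have hlim' := hlim.const_sub (V T - V 0 * Real.exp (-θ * T))
  have hend : V T - V 0 * Real.exp (-θ * T) - 0 = x T - (μ + (x₀ - μ) * Real.exp (-θ * T)) := by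
    have h00 : V 0 = x₀ - μ := by simp [hV, h0]
    rw [hVcoe, h00]
    ring
  rw [hend] at hlim'
  refine hlim'.congr fun n => ?_
  have htel : V T - V 0 * Real.exp (-θ * T) = ∑ k ∈ Finset.range (n + 1), Real.exp (-θ * T) *
      (Real.exp (θ * partitionPoint T n (k + 1)) * V (partitionPoint T n (k + 1)) -
        Real.exp (θ * partitionPoint T n k) * V (partitionPoint T n k)) := by
    rw [← Finset.mul_sum, Finset.sum_range_sub
      (fun k => Real.exp (θ * partitionPoint T n k) * V (partitionPoint T n k))]
    simp only [partitionPoint_last, partitionPoint_zero, NNReal.coe_zero, mul_zero, Real.exp_zero,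
      one_mul, mul_sub, ← mul_assoc, ← Real.exp_add]
    simp [mul_comm]
  rw [htel, ← Finset.sum_sub_distrib, stieltjesSum]
  refine Finset.sum_congr rfl fun k _ => ?_
  set a := partitionPoint T n k
  set b := partitionPoint T n (k + 1)
  have hexp : Real.exp (-θ * (T - a)) = Real.exp (-θ * T) * Real.exp (θ * a) := by
    rw [← Real.exp_add]
    ring_nf
  have hint : ∫ s in (a : ℝ)..b, θ * Real.exp (θ * s) = Real.exp (θ * b) - Real.exp (θ * a) := by
    refine intervalIntegral.integral_eq_sub_of_hasDerivAt (f := fun s => Real.exp (θ * s))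
      (fun s _ => ?_) (Continuous.intervalIntegrable (by fun_prop) _ _)
    simpa [mul_comm] using ((hasDerivAt_id s).const_mul θ).exp
  have hsplit : ∫ s in (a : ℝ)..b, Real.exp (-θ * T) * θ *
      (Real.exp (θ * s) * V b - Real.exp (θ * a) * V s) =
      Real.exp (-θ * T) * ((Real.exp (θ * b) - Real.exp (θ * a)) * V b -
        θ * Real.exp (θ * a) * ∫ s in (a : ℝ)..b, V s) := by
    rw [← hint, ← intervalIntegral.integral_mul_const, ← intervalIntegral.integral_const_mul,
      ← intervalIntegral.integral_sub, ← intervalIntegral.integral_const_mul]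
    · congr 1
      ext s
      ring
    · exact Continuous.intervalIntegrable (by fun_prop) _ _
    · exact Continuous.intervalIntegrable (by fun_prop) _ _
  rw [hsplit, hexp]
  linear_combination (-Real.exp (-θ * T) * Real.exp (θ * a)) * hinc a b

/-! ### Gaussian laws of the limits -/

section

variable {Ω : Type*} [MeasurableSpace Ω] {P : Measure Ω}

/-- The sum is a linear image of the jointly Gaussian increments, hence Gaussian; independence of
the increments makes their variances add. -/
lemma hasLaw_stieltjesSum {W : ℝ≥0 → Ω → ℝ} (hW : IsPreBrownianReal W P) (c : ℝ → ℝ)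
    (T : ℝ≥0) (n : ℕ) :
    HasLaw (fun ω => stieltjesSum c T n fun t => W t ω)
      (gaussianReal 0 (∑ k ∈ Finset.range (n + 1), c (partitionPoint T n k) ^ 2 *
        ((partitionPoint T n (k + 1) : ℝ) - partitionPoint T n k)).toNNReal) P := by
  have : IsProbabilityMeasure P := hW.isGaussianProcess.isProbabilityMeasure
  set D : Fin (n + 1) → Ω → ℝ := fun i ω =>
    W (partitionPoint T n (i + 1)) ω - W (partitionPoint T n i) ω with hD
  have hDG : HasGaussianLaw (fun ω i => D i ω) P := by
    simpa [hD] using hW.isGaussianProcess.hasGaussianLaw_increments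
      (t := fun i : Fin (n + 1 + 1) => partitionPoint T n i)
  have hDI : iIndepFun D P := by
    simpa [hD] using hW.hasIndepIncrements (n + 1) (fun i => partitionPoint T n i)
      fun i j hij => partitionPoint_mono T n hij
  have hDlaw : ∀ i, HasLaw (D i) (gaussianReal 0
      (nndist (partitionPoint T n (i + 1)).1 (partitionPoint T n i).1)) P :=
    fun i => hW.hasLaw_sub _ _
  have hsum : (fun ω => stieltjesSum c T n fun t => W t ω) =
      ∑ i : Fin (n + 1), fun ω => c (partitionPoint T n i) * D i ω := by
    ext ω
    simp [stieltjesSum, Finset.sum_range, hD]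
  have hmem : ∀ i, MemLp (D i) 2 P := fun i => (hDlaw i).hasGaussianLaw.memLp_two
  have hG : HasGaussianLaw (fun ω => stieltjesSum c T n fun t => W t ω) P := by
    rw [hsum]
    have hL := hDG.map (∑ i : Fin (n + 1), c (partitionPoint T n i) •
      ContinuousLinearMap.proj (R := ℝ) (φ := fun _ => ℝ) i)
    refine hL.congr (ae_of_all _ fun ω => ?_)
    simp
  refine ⟨hG.aemeasurable, ?_⟩
  rw [hG.map_eq_gaussianReal]
  congr 2
  · rw [hsum, Finset.sum_fn]
    rw [integral_finsetSum _ fun i _ => ((hmem i).integrable one_le_two).const_mul _]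
    refine Finset.sum_eq_zero fun i _ => ?_
    rw [integral_const_mul, (hDlaw i).integral_eq, integral_id_gaussianReal, mul_zero]
  · rw [hsum, IndepFun.variance_sum (fun i _ => (hmem i).const_mul _), Finset.sum_range]
    · refine Finset.sum_congr rfl fun i _ => ?_
      rw [variance_const_mul, (hDlaw i).variance_eq, variance_id_gaussianReal, coe_nndist,
        Real.dist_eq, abs_of_nonneg]
      · rfl
      · exact sub_nonneg.2 (NNReal.coe_le_coe.2 (partitionPoint_mono T n i.1.le_succ))
    · intro i _ j _ hij
      exact (hDI.indepFun hij).comp (measurable_const_mul _) (measurable_const_mul _)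

/-- An almost sure limit of centred Gaussian variables with convergent variances is Gaussian. -/
lemma hasLaw_gaussianReal_of_tendsto_ae [IsProbabilityMeasure P] {Z : ℕ → Ω → ℝ} {Y : Ω → ℝ}
    {v : ℕ → ℝ≥0} {v' : ℝ≥0} (hZ : ∀ n, HasLaw (Z n) (gaussianReal 0 (v n)) P)
    (hv : Tendsto v atTop (𝓝 v')) (hY : ∀ᵐ ω ∂P, Tendsto (fun n => Z n ω) atTop (𝓝 (Y ω))) :
    HasLaw Y (gaussianReal 0 v') P := by
  have hYm : AEMeasurable Y P :=
    aemeasurable_of_tendsto_metrizable_ae atTop (fun n => (hZ n).aemeasurable) hY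
  refine ⟨hYm, ?_⟩
  have : IsProbabilityMeasure (P.map Y) := Measure.isProbabilityMeasure_map hYm
  refine Measure.ext_of_charFun (funext fun t => ?_)
  -- Written as an expectation over `Ω`, the characteristic function passes to the almost sure limit
  -- by dominated convergence.
  have hchar : ∀ X : Ω → ℝ, AEMeasurable X P →
      charFun (P.map X) t = ∫ ω, Complex.exp (t * X ω * Complex.I) ∂P := by
    intro X hX
    rw [charFun_apply_real, integral_map hX]
    exact Continuous.aestronglyMeasurable (by fun_prop)
  have h1 : Tendsto (fun n => charFun (P.map (Z n)) t) atTop (𝓝 (charFun (P.map Y) t)) := by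
    rw [hchar Y hYm]
    simp_rw [fun n => hchar (Z n) (hZ n).aemeasurable]
    refine tendsto_integral_of_dominated_convergence (fun _ => 1) (fun n => ?_)
      (integrable_const _) (fun n => ?_) ?_
    · have := (hZ n).aemeasurable
      exact AEMeasurable.aestronglyMeasurable (by fun_prop)
    · refine ae_of_all _ fun ω => ?_
      rw [← Complex.ofReal_mul, Complex.norm_exp_ofReal_mul_I]
    · filter_upwards [hY] with ω hω
      have hc : Continuous fun x : ℝ => Complex.exp (t * x * Complex.I) := by fun_prop
      exact (hc.tendsto _).comp hω
  have h2 : Tendsto (fun n => charFun (P.map (Z n)) t) atTop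
      (𝓝 (charFun (gaussianReal 0 v') t)) := by
    simp_rw [fun n => (hZ n).map_eq, charFun_gaussianReal]
    have hc : Continuous fun x : ℝ≥0 => Complex.exp
        (t * (0 : ℝ) * Complex.I - (x : ℝ) * t ^ 2 / 2) := by fun_prop
    exact (hc.tendsto _).comp hv
  exact tendsto_nhds_unique h1 h2

/-- Wiener integrals of continuous integrands, obtained as almost sure limits of Stieltjes sums. -/
lemma hasLaw_of_tendsto_stieltjesSum [IsProbabilityMeasure P] {W : ℝ≥0 → Ω → ℝ}
    (hW : IsPreBrownianReal W P) {c : ℝ → ℝ} (hc : Continuous c) {T : ℝ≥0} {Y : Ω → ℝ}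
    (hY : ∀ᵐ ω ∂P, Tendsto (fun n => stieltjesSum c T n fun t => W t ω) atTop (𝓝 (Y ω))) :
    HasLaw Y (gaussianReal 0 (∫ s in (0 : ℝ)..T, c s ^ 2).toNNReal) P :=
  hasLaw_gaussianReal_of_tendsto_ae (hasLaw_stieltjesSum hW c T)
    ((continuous_real_toNNReal.tendsto _).comp
      (tendsto_leftRiemannSum (f := fun s => c s ^ 2) (by fun_prop) T)) hY

lemma IsOUProcess.tendsto_stieltjesSum {θ μ σ x₀ : ℝ} {W X : ℝ≥0 → Ω → ℝ}
    (h : IsOUProcess θ μ σ x₀ W X P) (T : ℝ≥0) :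
    ∀ᵐ ω ∂P, Tendsto (fun n => stieltjesSum (fun s => σ * Real.exp (-θ * (T - s))) T n
        fun t => W t ω) atTop (𝓝 (X T ω - (μ + (x₀ - μ) * Real.exp (-θ * T)))) := by
  filter_upwards [h.cont, h.init, h.sde] with ω h1 h2 h3
  exact tendsto_stieltjesSum_of_linear_equation h1 h2 h3 T

lemma stieltjesSum_linear (a b : ℝ) (c d : ℝ → ℝ) (T : ℝ≥0) (n : ℕ) (w : ℝ≥0 → ℝ) :
    stieltjesSum (fun s => a * c s + b * d s) T n w =
      a * stieltjesSum c T n w + b * stieltjesSum d T n w := by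
  simp only [stieltjesSum, Finset.mul_sum, ← Finset.sum_add_distrib]
  exact Finset.sum_congr rfl fun k _ => by ring

/-! ### Moments and independence of Ornstein-Uhlenbeck processes -/

/-- Square integrability and variance of linear combinations of Ornstein-Uhlenbeck processes
with a common driver. -/
lemma IsOUProcess.memLp_variance_linear [IsProbabilityMeasure P]
    {θ₁ μ₁ σ₁ x₁ θ₂ μ₂ σ₂ x₂ : ℝ} {W X₁ X₂ : ℝ≥0 → Ω → ℝ}
    (h₁ : IsOUProcess θ₁ μ₁ σ₁ x₁ W X₁ P) (h₂ : IsOUProcess θ₂ μ₂ σ₂ x₂ W X₂ P)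
    (a b : ℝ) (T : ℝ≥0) :
    MemLp (fun ω => a * X₁ T ω + b * X₂ T ω) 2 P ∧
      Var[fun ω => a * X₁ T ω + b * X₂ T ω; P] = ∫ u in (0 : ℝ)..T,
        (a * (σ₁ * Real.exp (-θ₁ * u)) + b * (σ₂ * Real.exp (-θ₂ * u))) ^ 2 := by
  set m : ℝ := a * (μ₁ + (x₁ - μ₁) * Real.exp (-θ₁ * T)) +
    b * (μ₂ + (x₂ - μ₂) * Real.exp (-θ₂ * T)) with hm
  have hlaw : HasLaw (fun ω => a * X₁ T ω + b * X₂ T ω - m) _ P :=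
    hasLaw_of_tendsto_stieltjesSum h₁.wiener.toIsPreBrownianReal
      (c := fun s => a * (σ₁ * Real.exp (-θ₁ * (T - s))) + b * (σ₂ * Real.exp (-θ₂ * (T - s))))
      (T := T) (by fun_prop) (by
        filter_upwards [h₁.tendsto_stieltjesSum T, h₂.tendsto_stieltjesSum T] with ω hω₁ hω₂
        simp_rw [stieltjesSum_linear]
        convert (hω₁.const_mul a).add (hω₂.const_mul b) using 2
        rw [hm]
        ring)
  have hmem : MemLp (fun ω => a * X₁ T ω + b * X₂ T ω) 2 P := by
    convert hlaw.hasGaussianLaw.memLp_two.add (memLp_const m) using 1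
    ext ω
    simp
  refine ⟨hmem, ?_⟩
  rw [← variance_sub_const hmem.aestronglyMeasurable m, hlaw.variance_eq, variance_id_gaussianReal,
    Real.coe_toNNReal]
  -- Time reversal `u = T - s` removes `T` from the integrand.
  · have := intervalIntegral.integral_comp_sub_left (a := 0) (b := (T : ℝ))
      (fun u => (a * (σ₁ * Real.exp (-θ₁ * u)) + b * (σ₂ * Real.exp (-θ₂ * u))) ^ 2) T
    simpa using this
  · exact intervalIntegral.integral_nonneg T.2 fun _ _ => sq_nonneg _

lemma IsOUProcess.memLp_variance [IsProbabilityMeasure P] {θ μ σ x₀ : ℝ} {W X : ℝ≥0 → Ω → ℝ}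
    (h : IsOUProcess θ μ σ x₀ W X P) (T : ℝ≥0) :
    MemLp (X T) 2 P ∧
      Var[X T; P] = σ ^ 2 * ∫ u in (0 : ℝ)..T, Real.exp (-(θ + θ) * u) := by
  have := h.memLp_variance_linear h 1 0 T
  simp only [one_mul, zero_mul, add_zero] at this
  refine ⟨this.1, this.2.trans ?_⟩
  rw [← intervalIntegral.integral_const_mul]
  congr 1
  ext u
  rw [mul_pow, sq (Real.exp _), ← Real.exp_add]
  ring_nf

/-- Polarisation: the variance of the sum is compared with the expanded square of the summed
kernels. -/
lemma IsOUProcess.covariance [IsProbabilityMeasure P]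
    {θ₁ μ₁ σ₁ x₁ θ₂ μ₂ σ₂ x₂ : ℝ} {W X₁ X₂ : ℝ≥0 → Ω → ℝ}
    (h₁ : IsOUProcess θ₁ μ₁ σ₁ x₁ W X₁ P) (h₂ : IsOUProcess θ₂ μ₂ σ₂ x₂ W X₂ P) (T : ℝ≥0) :
    cov[X₁ T, X₂ T; P] = σ₁ * σ₂ * ∫ u in (0 : ℝ)..T, Real.exp (-(θ₁ + θ₂) * u) := by
  obtain ⟨hm₁, hv₁⟩ := h₁.memLp_variance T
  obtain ⟨hm₂, hv₂⟩ := h₂.memLp_variance T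
  have hv := (h₁.memLp_variance_linear h₂ 1 1 T).2
  simp only [one_mul] at hv
  have hadd : Var[fun ω => X₁ T ω + X₂ T ω; P] = _ := variance_add hm₁ hm₂
  have hi : ∀ θ : ℝ, IntervalIntegrable (fun u => Real.exp (-θ * u)) volume 0 (T : ℝ) :=
    fun θ => Continuous.intervalIntegrable (by fun_prop) _ _
  have hexpand : (∫ u in (0 : ℝ)..T,
      (σ₁ * Real.exp (-θ₁ * u) + σ₂ * Real.exp (-θ₂ * u)) ^ 2) =
      σ₁ ^ 2 * (∫ u in (0 : ℝ)..T, Real.exp (-(θ₁ + θ₁) * u)) +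
      2 * (σ₁ * σ₂) * (∫ u in (0 : ℝ)..T, Real.exp (-(θ₁ + θ₂) * u)) +
      σ₂ ^ 2 * ∫ u in (0 : ℝ)..T, Real.exp (-(θ₂ + θ₂) * u) := by
    simp only [← intervalIntegral.integral_const_mul]
    rw [← intervalIntegral.integral_add ((hi _).const_mul _) ((hi _).const_mul _),
      ← intervalIntegral.integral_add (((hi _).const_mul _).add ((hi _).const_mul _))
        ((hi _).const_mul _)]
    congr 1
    ext u
    simp only [neg_add, add_mul, Real.exp_add]
    ring
  rw [hexpand, hadd, hv₁, hv₂] at hv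
  linarith

/-- The value at a fixed time of an Ornstein-Uhlenbeck process is a function of its driver. -/
lemma IsOUProcess.exists_measurable_driver {θ μ σ x₀ : ℝ} {W X : ℝ≥0 → Ω → ℝ}
    (h : IsOUProcess θ μ σ x₀ W X P) (T : ℝ≥0) :
    ∃ φ : (ℝ≥0 → ℝ) → ℝ, Measurable φ ∧ (φ ∘ fun ω t => W t ω) =ᵐ[P] X T := by
  -- The `limsup` is measurable on all of path space and agrees with the limit on almost every path
  -- of the driver.
  refine ⟨fun w => limsup (fun n => stieltjesSum (fun s => σ * Real.exp (-θ * (T - s))) T n w)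
    atTop + (μ + (x₀ - μ) * Real.exp (-θ * T)),
    (Measurable.limsup fun n => measurable_stieltjesSum _ T n).add_const _, ?_⟩
  filter_upwards [h.tendsto_stieltjesSum T] with ω hω
  rw [Function.comp_apply, hω.limsup_eq, sub_add_cancel]

lemma IsOUProcess.indepFun {θ₁ μ₁ σ₁ x₁ θ₂ μ₂ σ₂ x₂ : ℝ} {W₁ W₂ X₁ X₂ : ℝ≥0 → Ω → ℝ}
    (h₁ : IsOUProcess θ₁ μ₁ σ₁ x₁ W₁ X₁ P) (h₂ : IsOUProcess θ₂ μ₂ σ₂ x₂ W₂ X₂ P)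
    (hW : IndepFun (fun ω (t : ℝ≥0) => W₁ t ω) (fun ω (t : ℝ≥0) => W₂ t ω) P) (T : ℝ≥0) :
    IndepFun (X₁ T) (X₂ T) P := by
  obtain ⟨φ, hφ, hφX⟩ := h₁.exists_measurable_driver T
  obtain ⟨ψ, hψ, hψX⟩ := h₂.exists_measurable_driver T
  exact (hW.comp hφ hψ).congr hφX hψX

end

/-! ### Estimates for exponential integrals -/

lemma integral_exp_neg_mul {r : ℝ} (hr : 0 < r) (T : ℝ) :
    ∫ u in (0 : ℝ)..T, Real.exp (-r * u) = (1 - Real.exp (-r * T)) / r := by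
  rw [intervalIntegral.integral_eq_sub_of_hasDerivAt (f := fun u => -(Real.exp (-r * u)) / r)
    (fun u _ => ?_) (Continuous.intervalIntegrable (by fun_prop) _ _)]
  · rw [mul_zero, Real.exp_zero]
    ring
  · have := ((((hasDerivAt_id u).const_mul (-r)).exp).neg).div_const r
    refine this.congr_deriv ?_
    simp only [id_eq]
    field_simp

lemma abs_exp_neg_sub_exp_neg_le {x y : ℝ} (hx : 0 ≤ x) (hy : 0 ≤ y) :
    |Real.exp (-x) - Real.exp (-y)| ≤ |x - y| := by
  wlog h : x ≤ y generalizing x y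
  · rw [abs_sub_comm, abs_sub_comm x]
    exact this hy hx (le_of_not_ge h)
  have h1 : Real.exp (-y) ≤ Real.exp (-x) := Real.exp_le_exp.2 (neg_le_neg h)
  have h2 : Real.exp (-x) ≤ 1 := Real.exp_le_one_iff.2 (by linarith)
  have h3 : Real.exp (-y) = Real.exp (-x) * Real.exp (x - y) := by
    rw [← Real.exp_add]
    ring_nf
  -- This gives `e^{-x} (1 - e^{x-y}) ≤ e^{-x} (y - x) ≤ y - x`.
  have h4 := Real.add_one_le_exp (x - y)
  rw [abs_of_nonneg (sub_nonneg.2 h1), abs_of_nonpos (by linarith), h3]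
  nlinarith [Real.exp_pos (-x)]

lemma abs_integral_exp_neg_mul_sub_le {r s : ℝ} (hr : 0 ≤ r) (hs : 0 ≤ s) (T : ℝ≥0) :
    |(∫ u in (0 : ℝ)..T, Real.exp (-r * u)) - ∫ u in (0 : ℝ)..T, Real.exp (-s * u)| ≤
      (T : ℝ) ^ 2 * |r - s| := by
  rw [← intervalIntegral.integral_sub (Continuous.intervalIntegrable (by fun_prop) _ _)
    (Continuous.intervalIntegrable (by fun_prop) _ _), ← Real.norm_eq_abs]
  refine (intervalIntegral.norm_integral_le_of_norm_le_const (C := T * |r - s|)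
    fun u hu => ?_).trans_eq ?_
  · rw [Set.uIoc_of_le T.coe_nonneg] at hu
    have := abs_exp_neg_sub_exp_neg_le (mul_nonneg hr hu.1.le) (mul_nonneg hs hu.1.le)
    rw [Real.norm_eq_abs, neg_mul, neg_mul]
    refine this.trans ?_
    rw [← sub_mul, abs_mul, abs_of_pos hu.1, mul_comm]
    exact mul_le_mul_of_nonneg_right hu.2 (abs_nonneg _)
  · rw [sub_zero, abs_of_nonneg T.coe_nonneg]
    ring

lemma integral_exp_neg_mul_nonneg (r : ℝ) (T : ℝ≥0) :
    0 ≤ ∫ u in (0 : ℝ)..T, Real.exp (-r * u) :=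
  intervalIntegral.integral_nonneg T.2 fun _ _ => (Real.exp_pos _).le

lemma integral_exp_neg_mul_le {r : ℝ} (hr : 0 ≤ r) (T : ℝ≥0) :
    ∫ u in (0 : ℝ)..T, Real.exp (-r * u) ≤ T := by
  have := intervalIntegral.integral_mono_on (μ := volume) (a := 0) (b := (T : ℝ))
    (f := fun u => Real.exp (-r * u)) (g := fun _ => 1) T.2
    (Continuous.intervalIntegrable (by fun_prop) _ _) intervalIntegrable_const
    fun u hu => Real.exp_le_one_iff.2 (by nlinarith [hu.1])
  simpa using this

lemma tendsto_integral_exp_neg_mul {r : ℝ} (hr : 0 < r) :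
    Tendsto (fun T : ℝ≥0 => ∫ u in (0 : ℝ)..T, Real.exp (-r * u)) atTop (𝓝 (1 / r)) := by
  simp_rw [fun T : ℝ≥0 => integral_exp_neg_mul hr T]
  have h : Tendsto (fun T : ℝ≥0 => Real.exp (-r * T)) atTop (𝓝 0) :=
    Real.tendsto_exp_atBot.comp
      ((NNReal.tendsto_coe_atTop.2 tendsto_id).const_mul_atTop_of_neg (neg_lt_zero.2 hr))
  simpa using (h.const_sub 1).div_const r

lemma stationary_variance_pos {θ₁ θ₂ σ₁ σ₂ : ℝ} (hθ₁ : 0 < θ₁) (hθ₂ : 0 < θ₂) (hσ₁ : 0 < σ₁)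
    (hne : (θ₁, σ₁) ≠ (θ₂, σ₂)) :
    0 < σ₁ ^ 2 / (2 * θ₁) + σ₂ ^ 2 / (2 * θ₂) - 2 * (σ₁ * σ₂ / (θ₁ + θ₂)) := by
  -- Both squares vanish only if `σ₁ = σ₂` and then `θ₁ = θ₂`.
  have heq : σ₁ ^ 2 / (2 * θ₁) + σ₂ ^ 2 / (2 * θ₂) - 2 * (σ₁ * σ₂ / (θ₁ + θ₂)) =
      ((θ₂ * σ₁ - θ₁ * σ₂) ^ 2 + θ₁ * θ₂ * (σ₁ - σ₂) ^ 2) / (2 * θ₁ * θ₂ * (θ₁ + θ₂)) := by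
    field_simp
    ring
  rw [heq]
  refine div_pos ?_ (by positivity)
  by_cases hσ : σ₁ = σ₂
  · subst hσ
    have hθ : θ₂ - θ₁ ≠ 0 := fun h => hne (by rw [sub_eq_zero.1 h])
    have : θ₂ * σ₁ - θ₁ * σ₁ ≠ 0 := by
      rw [← sub_mul]
      exact mul_ne_zero hθ hσ₁.ne'
    positivity
  · have : σ₁ - σ₂ ≠ 0 := sub_ne_zero.2 hσ
    positivity

/-! ### Finite difference shifts -/

namespace FirstOrderDifference

lemma abs_shift₁_le (d : FirstOrderDifference) (ε : ℝ) : |d.shift₁ ε| ≤ |ε| := by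
  cases d <;> simp [shift₁]

lemma abs_shift₂_le (d : FirstOrderDifference) (ε : ℝ) : |d.shift₂ ε| ≤ |ε| := by
  cases d <;> simp [shift₂]

lemma abs_shift_sub_le (d : FirstOrderDifference) (ε : ℝ) :
    |d.shift₁ ε - d.shift₂ ε| ≤ 2 * |ε| := by
  have := abs_sub (d.shift₁ ε) (d.shift₂ ε)
  linarith [d.abs_shift₁_le ε, d.abs_shift₂_le ε]

lemma pos_add_shift (d : FirstOrderDifference) {θ ε : ℝ} (hε : |ε| < θ) :
    0 < θ + d.shift₁ ε ∧ 0 < θ + d.shift₂ ε := by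
  have h₁ := neg_abs_le (d.shift₁ ε)
  have h₂ := neg_abs_le (d.shift₂ ε)
  constructor <;> linarith [d.abs_shift₁_le ε, d.abs_shift₂_le ε]

end FirstOrderDifference

/-! ### Variance of the difference under the two couplings -/

section

variable {Ω : Type*} [MeasurableSpace Ω] {P : Measure Ω} [IsProbabilityMeasure P]

lemma IsCommonPathPair.memLp_variance_sub {θ₁ σ₁ θ₂ σ₂ μ x₀ : ℝ} {X₁ X₂ : ℝ≥0 → Ω → ℝ}
    (h : IsCommonPathPair θ₁ σ₁ θ₂ σ₂ μ x₀ X₁ X₂ P) (T : ℝ≥0) :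
    MemLp (X₁ T - X₂ T) 2 P ∧ Var[X₁ T - X₂ T; P] = ∫ u in (0 : ℝ)..T,
      (σ₁ * Real.exp (-θ₁ * u) - σ₂ * Real.exp (-θ₂ * u)) ^ 2 := by
  obtain ⟨W, h₁, h₂⟩ := h
  have := h₁.memLp_variance_linear h₂ 1 (-1) T
  simp only [one_mul, neg_one_mul, ← sub_eq_add_neg] at this
  exact this

/-- A uniform bound on the difference of the kernels bounds the variance of the difference. -/
lemma IsCommonPathPair.variance_sub_le {θ₁ σ₁ θ₂ σ₂ μ x₀ : ℝ} {X₁ X₂ : ℝ≥0 → Ω → ℝ}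
    (h : IsCommonPathPair θ₁ σ₁ θ₂ σ₂ μ x₀ X₁ X₂ P) {T : ℝ≥0} {K : ℝ}
    (hK : ∀ u : ℝ, 0 ≤ u → u ≤ T →
      |σ₁ * Real.exp (-θ₁ * u) - σ₂ * Real.exp (-θ₂ * u)| ≤ K) :
    Var[X₁ T - X₂ T; P] ≤ T * K ^ 2 := by
  rw [(h.memLp_variance_sub T).2]
  have := intervalIntegral.integral_mono_on (μ := volume) (a := 0) (b := (T : ℝ))
    (f := fun u => (σ₁ * Real.exp (-θ₁ * u) - σ₂ * Real.exp (-θ₂ * u)) ^ 2)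
    (g := fun _ => K ^ 2) T.2
    (Continuous.intervalIntegrable (by fun_prop) _ _) intervalIntegrable_const
    fun u hu => by
      rw [← sq_abs]
      exact pow_le_pow_left₀ (abs_nonneg _) (hK u hu.1 hu.2) 2
  simpa using this

lemma IsIndependentPathPair.memLp_variance_sub {θ₁ σ₁ θ₂ σ₂ μ x₀ : ℝ} {X₁ X₂ : ℝ≥0 → Ω → ℝ}
    (h : IsIndependentPathPair θ₁ σ₁ θ₂ σ₂ μ x₀ X₁ X₂ P) (T : ℝ≥0) :
    MemLp (X₁ T - X₂ T) 2 P ∧ Var[X₁ T - X₂ T; P] = Var[X₁ T; P] + Var[X₂ T; P] ∧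
      Var[X₁ T - X₂ T; P] = σ₁ ^ 2 * (∫ u in (0 : ℝ)..T, Real.exp (-(θ₁ + θ₁) * u)) +
        σ₂ ^ 2 * ∫ u in (0 : ℝ)..T, Real.exp (-(θ₂ + θ₂) * u) := by
  obtain ⟨W₁, W₂, hW, h₁, h₂⟩ := h
  obtain ⟨hm₁, hv₁⟩ := h₁.memLp_variance T
  obtain ⟨hm₂, hv₂⟩ := h₂.memLp_variance T
  have hv : Var[X₁ T - X₂ T; P] = Var[X₁ T; P] + Var[X₂ T; P] := by
    rw [variance_sub hm₁ hm₂, (h₁.indepFun h₂ hW T).covariance_eq_zero hm₁ hm₂]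
    ring
  exact ⟨hm₁.sub hm₂, hv, by rw [hv, hv₁, hv₂]⟩

end

/-! ### Long-time limit and asymptotics in the step -/

lemma ornsteinUhlenbeck_covariance_and_limit {Ω : Type*} [MeasurableSpace Ω] {P : Measure Ω}
    [IsProbabilityMeasure P] {W X₁ X₂ : ℝ≥0 → Ω → ℝ} {θ₁ θ₂ σ₁ σ₂ μ₁ μ₂ x₁ x₂ : ℝ}
    (hθ₁ : 0 < θ₁) (hθ₂ : 0 < θ₂)
    (h₁ : IsOUProcess θ₁ μ₁ σ₁ x₁ W X₁ P) (h₂ : IsOUProcess θ₂ μ₂ σ₂ x₂ W X₂ P) :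
    (∀ T : ℝ≥0, MemLp (X₁ T) 2 P ∧ MemLp (X₂ T) 2 P ∧
      cov[X₁ T, X₂ T; P] =
        σ₁ * σ₂ * (1 - Real.exp (-(θ₁ + θ₂) * (T : ℝ))) / (θ₁ + θ₂)) ∧
    Tendsto (fun T : ℝ≥0 => Var[X₁ T - X₂ T; P]) atTop
      (𝓝 (σ₁ ^ 2 / (2 * θ₁) + σ₂ ^ 2 / (2 * θ₂) - 2 * (σ₁ * σ₂ / (θ₁ + θ₂)))) := by
  refine ⟨fun T => ⟨(h₁.memLp_variance T).1, (h₂.memLp_variance T).1, ?_⟩, ?_⟩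
  · rw [h₁.covariance h₂, integral_exp_neg_mul (add_pos hθ₁ hθ₂), mul_div_assoc]
  · have hlim := (((tendsto_integral_exp_neg_mul (add_pos hθ₁ hθ₁)).const_mul (σ₁ ^ 2)).sub
      (((tendsto_integral_exp_neg_mul (add_pos hθ₁ hθ₂)).const_mul (σ₁ * σ₂)).const_mul 2)).add
      ((tendsto_integral_exp_neg_mul (add_pos hθ₂ hθ₂)).const_mul (σ₂ ^ 2))
    convert hlim using 1
    · ext T
      rw [variance_sub (h₁.memLp_variance T).1 (h₂.memLp_variance T).1, h₁.covariance h₂,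
        (h₁.memLp_variance T).2, (h₂.memLp_variance T).2]
    · congr 1
      ring

/-- Common random paths give a variance of the difference which is quadratic in the step. -/
lemma exists_variance_sub_le_commonPath (d : FirstOrderDifference) {θ σ : ℝ} {T : ℝ≥0}
    (hθ : 0 < θ) (hT : 0 < T) :
    ∃ C ε₀ : ℝ, 0 < C ∧ 0 < ε₀ ∧ ∀ ε : ℝ, |ε| < ε₀ →
      ∀ (Ω : Type u) [MeasurableSpace Ω] (P : Measure Ω) [IsProbabilityMeasure P]
        (X₁ X₂ : ℝ≥0 → Ω → ℝ) (μ x₀ : ℝ),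
        (IsCommonPathPair (θ + d.shift₁ ε) σ (θ + d.shift₂ ε) σ μ x₀ X₁ X₂ P ∨
          IsCommonPathPair θ (σ + d.shift₁ ε) θ (σ + d.shift₂ ε) μ x₀ X₁ X₂ P) →
        MemLp (X₁ T - X₂ T) 2 P ∧ Var[X₁ T - X₂ T; P] ≤ C * ε ^ 2 := by
  have hT' : (0 : ℝ) < T := hT
  -- The kernels differ by at most `2|ε| |σ| T` (shift in `θ`) or `2|ε|` (shift in `σ`); `(|σ| T +
  -- 1) 2|ε|` covers both. The range `|ε| < θ` keeps both rates positive.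
  refine ⟨4 * T * (|σ| * T + 1) ^ 2, θ, by positivity, hθ, ?_⟩
  intro ε hε Ω _ P _ X₁ X₂ μ x₀ hpair
  have hd := d.abs_shift_sub_le ε
  have hC : 4 * T * (|σ| * T + 1) ^ 2 * ε ^ 2 = T * ((|σ| * T + 1) * (2 * |ε|)) ^ 2 := by
    rw [← sq_abs ε]
    ring
  rw [hC]
  rcases hpair with h | h
  · refine ⟨(h.memLp_variance_sub T).1, h.variance_sub_le fun u hu huT => ?_⟩
    obtain ⟨hp₁, hp₂⟩ := d.pos_add_shift hε
    have hexp := abs_exp_neg_sub_exp_neg_le (mul_nonneg hp₁.le hu) (mul_nonneg hp₂.le hu)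
    rw [← sub_mul, add_sub_add_left_eq_sub, abs_mul, abs_of_nonneg hu] at hexp
    rw [← mul_sub, abs_mul, neg_mul, neg_mul]
    calc |σ| * |Real.exp (-((θ + d.shift₁ ε) * u)) - Real.exp (-((θ + d.shift₂ ε) * u))|
        ≤ |σ| * (2 * |ε| * T) := by
          gcongr
          exact hexp.trans (by gcongr)
      _ ≤ (|σ| * T + 1) * (2 * |ε|) := by linarith [abs_nonneg ε]
  · refine ⟨(h.memLp_variance_sub T).1, h.variance_sub_le fun u hu huT => ?_⟩
    have hexp : Real.exp (-θ * u) ≤ 1 := Real.exp_le_one_iff.2 (by nlinarith)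
    rw [← sub_mul, add_sub_add_left_eq_sub, abs_mul, Real.abs_exp]
    calc |d.shift₁ ε - d.shift₂ ε| * Real.exp (-θ * u) ≤ 2 * |ε| * 1 := by gcongr
      _ ≤ (|σ| * T + 1) * (2 * |ε|) := by
        have : 0 ≤ |σ| * T * (2 * |ε|) := by positivity
        linarith

/-- Perturbation of the variance of an Ornstein-Uhlenbeck process in either parameter. -/
lemma abs_variance_perturbation_le {θ σ a ε : ℝ} (T : ℝ≥0) (hσ : 0 < σ) (hθ : 0 < θ)
    (ha : |a| ≤ |ε|) (hεθ : |ε| < θ) (hεσ : |ε| < σ) :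
    |(σ ^ 2 * ∫ u in (0 : ℝ)..T, Real.exp (-((θ + a) + (θ + a)) * u)) -
        σ ^ 2 * ∫ u in (0 : ℝ)..T, Real.exp (-(θ + θ) * u)| ≤
      (2 * σ ^ 2 * T ^ 2 + 3 * σ * T) * |ε| ∧
    |((σ + a) ^ 2 * ∫ u in (0 : ℝ)..T, Real.exp (-(θ + θ) * u)) -
        σ ^ 2 * ∫ u in (0 : ℝ)..T, Real.exp (-(θ + θ) * u)| ≤
      (2 * σ ^ 2 * T ^ 2 + 3 * σ * T) * |ε| := by
  have hna := neg_abs_le a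
  have hT : (0 : ℝ) ≤ T := T.2
  constructor
  · have h := abs_integral_exp_neg_mul_sub_le (r := (θ + a) + (θ + a)) (s := θ + θ)
      (by linarith) (by linarith) T
    have h2 : |θ + a + (θ + a) - (θ + θ)| ≤ 2 * |ε| := by
      rw [show θ + a + (θ + a) - (θ + θ) = 2 * a by ring, abs_mul, abs_two]
      linarith
    rw [← mul_sub, abs_mul, abs_of_nonneg (sq_nonneg σ)]
    calc _ ≤ σ ^ 2 * ((T : ℝ) ^ 2 * (2 * |ε|)) := by
          gcongr
          exact h.trans (by gcongr)
      _ ≤ _ := by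
          have : 0 ≤ 3 * σ * T * |ε| := by positivity
          linarith
  · have hE := integral_exp_neg_mul_le (r := θ + θ) (by linarith) T
    have hE0 := integral_exp_neg_mul_nonneg (θ + θ) T
    have h2 : |(σ + a) ^ 2 - σ ^ 2| ≤ 3 * σ * |ε| := by
      rw [show (σ + a) ^ 2 - σ ^ 2 = (2 * σ + a) * a by ring, abs_mul]
      have : |2 * σ + a| ≤ 3 * σ := by
        refine (abs_add_le _ _).trans ?_
        rw [abs_of_pos (by positivity)]
        linarith
      gcongr
    rw [← sub_mul, abs_mul, abs_of_nonneg hE0]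
    calc _ ≤ 3 * σ * |ε| * T := by gcongr
      _ ≤ _ := by
          have : 0 ≤ 2 * σ ^ 2 * T ^ 2 * |ε| := by positivity
          linarith

/-- Independent paths give a variance of the difference which is exactly of order one. -/
lemma exists_variance_sub_bounds_independentPath (d : FirstOrderDifference) {θ σ : ℝ} {T : ℝ≥0}
    (hθ : 0 < θ) (hσ : 0 < σ) (hT : 0 < T) :
    ∃ c C ε₀ : ℝ, 0 < c ∧ 0 < C ∧ 0 < ε₀ ∧ ∀ ε : ℝ, |ε| < ε₀ →
      ∀ (Ω : Type u) [MeasurableSpace Ω] (P : Measure Ω) [IsProbabilityMeasure P]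
        (X₁ X₂ : ℝ≥0 → Ω → ℝ) (μ x₀ : ℝ),
        (IsIndependentPathPair (θ + d.shift₁ ε) σ (θ + d.shift₂ ε) σ μ x₀ X₁ X₂ P ∨
          IsIndependentPathPair θ (σ + d.shift₁ ε) θ (σ + d.shift₂ ε) μ x₀ X₁ X₂ P) →
        MemLp (X₁ T - X₂ T) 2 P ∧
        Var[X₁ T - X₂ T; P] = Var[X₁ T; P] + Var[X₂ T; P] ∧
        |Var[X₁ T - X₂ T; P] -
          (σ ^ 2 * θ⁻¹ - σ ^ 2 * θ⁻¹ * Real.exp (-2 * (T : ℝ) * θ))| ≤ C * |ε| ∧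
        c ≤ Var[X₁ T - X₂ T; P] ∧ Var[X₁ T - X₂ T; P] ≤ C := by
  have hT' : (0 : ℝ) < T := hT
  set V := σ ^ 2 * ∫ u in (0 : ℝ)..T, Real.exp (-(θ + θ) * u) with hV
  have hVeq : σ ^ 2 * θ⁻¹ - σ ^ 2 * θ⁻¹ * Real.exp (-2 * (T : ℝ) * θ) = V + V := by
    rw [hV, integral_exp_neg_mul (add_pos hθ hθ),
      show -2 * (T : ℝ) * θ = -(θ + θ) * T by ring]
    field_simp
  have hVpos : 0 < V := by
    rw [hV, integral_exp_neg_mul (add_pos hθ hθ)]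
    have : Real.exp (-(θ + θ) * T) < 1 :=
      Real.exp_lt_one_iff.2 (by rw [neg_mul]; exact neg_lt_zero.2 (by positivity))
    have h1 : 0 < 1 - Real.exp (-(θ + θ) * T) := by linarith
    positivity
  set A := 2 * σ ^ 2 * (T : ℝ) ^ 2 + 3 * σ * T with hA
  have hApos : 0 < A := by positivity
  -- The limiting variance is `2V` and the error at most `2A|ε|`. Once `|ε| < V / (2A)` the variance
  -- lies in `[V, 3V]`; the upper constant serves both as this bound and as the `O(ε)` constant.
  refine ⟨V, 2 * A + 3 * V, min (min θ σ) (V / (2 * A)), hVpos, by positivity, by positivity, ?_⟩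
  intro ε hε Ω _ P _ X₁ X₂ μ x₀ hpair
  have hεθ : |ε| < θ := hε.trans_le ((min_le_left _ _).trans (min_le_left _ _))
  have hεσ : |ε| < σ := hε.trans_le ((min_le_left _ _).trans (min_le_right _ _))
  have hεV : 2 * A * |ε| ≤ V := by
    have := (lt_div_iff₀ (by positivity)).1 (hε.trans_le (min_le_right _ _))
    linarith
  obtain ⟨p₁, q₁⟩ := abs_variance_perturbation_le T hσ hθ (d.abs_shift₁_le ε) hεθ hεσ
  obtain ⟨p₂, q₂⟩ := abs_variance_perturbation_le T hσ hθ (d.abs_shift₂_le ε) hεθ hεσ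
  rw [← hV, ← hA] at p₁ q₁ p₂ q₂
  have key : MemLp (X₁ T - X₂ T) 2 P ∧ Var[X₁ T - X₂ T; P] = Var[X₁ T; P] + Var[X₂ T; P] ∧
      |Var[X₁ T - X₂ T; P] - (V + V)| ≤ 2 * A * |ε| := by
    rcases hpair with h | h
    all_goals
      obtain ⟨hm, hs, hv⟩ := h.memLp_variance_sub T
      refine ⟨hm, hs, ?_⟩
      rw [hv, add_sub_add_comm]
      refine (abs_add_le _ _).trans ?_
      linarith
  obtain ⟨hm, hs, hb⟩ := key
  have hb' := abs_le.1 hb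
  rw [hVeq]
  refine ⟨hm, hs, hb.trans ?_, by linarith, by linarith⟩
  have : 0 ≤ 3 * V * |ε| := by positivity
  linarith

theorem mainTheorem2 :
    -- covariance under a common Wiener process, and the limit of the variance of the difference
    (∀ (Ω : Type u) [MeasurableSpace Ω] (P : Measure Ω) [IsProbabilityMeasure P]
      (W X₁ X₂ : ℝ≥0 → Ω → ℝ) (θ₁ θ₂ σ₁ σ₂ μ₁ μ₂ x₁ x₂ : ℝ),
      0 < θ₁ → 0 < θ₂ → 0 < σ₁ → 0 < σ₂ →
      IsOUProcess θ₁ μ₁ σ₁ x₁ W X₁ P → IsOUProcess θ₂ μ₂ σ₂ x₂ W X₂ P →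
      (∀ T : ℝ≥0, MemLp (X₁ T) 2 P ∧ MemLp (X₂ T) 2 P ∧
        cov[X₁ T, X₂ T; P] =
          σ₁ * σ₂ * (1 - Real.exp (-(θ₁ + θ₂) * (T : ℝ))) / (θ₁ + θ₂)) ∧
      Tendsto (fun T : ℝ≥0 => Var[X₁ T - X₂ T; P]) atTop
        (𝓝 (σ₁ ^ 2 / (2 * θ₁) + σ₂ ^ 2 / (2 * θ₂) - 2 * (σ₁ * σ₂ / (θ₁ + θ₂)))) ∧
      ((θ₁, σ₁) ≠ (θ₂, σ₂) →
        0 < σ₁ ^ 2 / (2 * θ₁) + σ₂ ^ 2 / (2 * θ₂) - 2 * (σ₁ * σ₂ / (θ₁ + θ₂)))) ∧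
    -- common random paths: `O(ε ^ 2)`, for the sensitivity in `θ` and in `σ`
    (∀ (d : FirstOrderDifference) (θ σ : ℝ) (T : ℝ≥0), 0 < θ → 0 < σ → 0 < T →
      ∃ C ε₀ : ℝ, 0 < C ∧ 0 < ε₀ ∧ ∀ ε : ℝ, |ε| < ε₀ →
        ∀ (Ω : Type u) [MeasurableSpace Ω] (P : Measure Ω) [IsProbabilityMeasure P]
          (X₁ X₂ : ℝ≥0 → Ω → ℝ) (μ x₀ : ℝ),
          (IsCommonPathPair (θ + d.shift₁ ε) σ (θ + d.shift₂ ε) σ μ x₀ X₁ X₂ P ∨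
            IsCommonPathPair θ (σ + d.shift₁ ε) θ (σ + d.shift₂ ε) μ x₀ X₁ X₂ P) →
          MemLp (X₁ T - X₂ T) 2 P ∧ Var[X₁ T - X₂ T; P] ≤ C * ε ^ 2) ∧
    -- independent paths: exactly of order one, with the leading term
    (∀ (d : FirstOrderDifference) (θ σ : ℝ) (T : ℝ≥0), 0 < θ → 0 < σ → 0 < T →
      ∃ c C ε₀ : ℝ, 0 < c ∧ 0 < C ∧ 0 < ε₀ ∧ ∀ ε : ℝ, |ε| < ε₀ →
        ∀ (Ω : Type u) [MeasurableSpace Ω] (P : Measure Ω) [IsProbabilityMeasure P]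
          (X₁ X₂ : ℝ≥0 → Ω → ℝ) (μ x₀ : ℝ),
          (IsIndependentPathPair (θ + d.shift₁ ε) σ (θ + d.shift₂ ε) σ μ x₀ X₁ X₂ P ∨
            IsIndependentPathPair θ (σ + d.shift₁ ε) θ (σ + d.shift₂ ε) μ x₀ X₁ X₂ P) →
          MemLp (X₁ T - X₂ T) 2 P ∧
          Var[X₁ T - X₂ T; P] = Var[X₁ T; P] + Var[X₂ T; P] ∧
          |Var[X₁ T - X₂ T; P] -
            (σ ^ 2 * θ⁻¹ - σ ^ 2 * θ⁻¹ * Real.exp (-2 * (T : ℝ) * θ))| ≤ C * |ε| ∧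
          c ≤ Var[X₁ T - X₂ T; P] ∧ Var[X₁ T - X₂ T; P] ≤ C) := by
  refine ⟨?_, ?_, ?_⟩
  · intro Ω _ P _ W X₁ X₂ θ₁ θ₂ σ₁ σ₂ μ₁ μ₂ x₁ x₂ hθ₁ hθ₂ hσ₁ _ h₁ h₂
    obtain ⟨hcov, hlim⟩ := ornsteinUhlenbeck_covariance_and_limit hθ₁ hθ₂ h₁ h₂
    exact ⟨hcov, hlim, stationary_variance_pos hθ₁ hθ₂ hσ₁⟩
  · intro d θ σ T hθ _ hT
    exact exists_variance_sub_le_commonPath d hθ hT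
  · intro d θ σ T hθ hσ hT
    exact exists_variance_sub_bounds_independentPath d hθ hσ hT
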